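/- An additive $[n,\kappa,d]_4$ code is an additive subgroup $C$ of $\mathbb F_4^n$ with $\log_4|C|=\kappa$ whose nonzero codewords have minimum Hamming weight $d$. Its weight distribution is $1+A_1z+\cdots+A_nz^n$, where $A_i$ is the number of codewords of weight $i$, and $C$ is a $t$-weight code if exactly $t$ of $A_1,\dots,A_n$ are nonzero. Put $g(m,d)=\sum_{i=0}^{m-1}\lceil d/2^i\rceil$. An additive $[n,m/2,d]_4$ code with $d<n$ is called Griesmer distance-optimal (GDO) if $3n<g(m,2d+2)$, and Griesmer puncture-optimal (GPO) if $3n+3<g(m,2d+2)$. An additive $[n,\kappa_1,\delta_1]_4$ code $C$ has a subcode $S$ as an invariant subcode with parameters $[n,\kappa_2,\delta_2]_4$ if $S$ is an $[n,\kappa_2,\delta_2]_4$ code, $\delta_2>\delta_1$, and $C$ has an $[n,\kappa_1-\kappa_2,\delta_1]_4$ subcode $S_1$ with $S_1\cap S=\{0\}$ such that the minimum of the weights of $c_1+c_2$, over all nonzero $c_1\in S_1$ and nonzero $c_2\in S$, is $\delta_2$. Let $k\ge 7$ be odd, let $k_2$ be even with $4\le k_2\le k-3$, and put $k_1=k-k_2$,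 $n=\frac{2^k-2^{k_2}+2}{3}$ (an integer) and $d=2^{k-2}-2^{k_2-2}$. Then there exists a four-weight additive $[n,\frac k2,d]_4$ code with weight distribution $$1+(2^{k-1}-2^{k_1-1})z^{d}+(2^{k-1}-2^{k_1-1})z^{d+1}+(2^{k_1-1}-1)z^{2^{k-2}}+2^{k_1-1}z^{2^{k-2}+1},$$ which has an invariant subcode with parameters $[n,\tfrac12,d+1]_4$. This code is GDO, and if $k_2\neq 4$ it is GPO. -/

import Mathlib

open Polynomial

/-- The field with four elements. -/
abbrev F4 : Type := GaloisField 2 2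

namespace AdditiveCode

/-- A quaternary additive code of length `n`: an additive subgroup of `F4 ^ n`. -/
abbrev Code (n : ℕ) : Type := AddSubgroup (Fin n → F4)

open Classical in
/-- Hamming weight: the number of nonzero coordinates. -/
noncomputable def weight {n : ℕ} (c : Fin n → F4) : ℕ := hammingNorm c

/-- The (possibly non-integral) quaternary dimension `log₄ |C|`. -/
noncomputable def dim {n : ℕ} (C : Code n) : ℝ := Real.logb 4 (Nat.card C)

/-- `C` is an additive `[n, κ, d]₄` code: it has dimension `κ`, and the minimum Hamming weight of
its nonzero codewords is `d` (in particular there is a nonzero codeword). -/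
def HasParams {n : ℕ} (C : Code n) (κ : ℝ) (d : ℕ) : Prop :=
  dim C = κ ∧ IsLeast {w : ℕ | ∃ c ∈ C, c ≠ 0 ∧ weight c = w} d

/-- `A_i`, the number of codewords of weight `i`. -/
noncomputable def weightCount {n : ℕ} (C : Code n) (i : ℕ) : ℕ :=
  {c : Fin n → F4 | c ∈ C ∧ weight c = i}.ncard

/-- The weight distribution `1 + A₁ z + A₂ z² + ⋯ + Aₙ zⁿ`. -/
noncomputable def weightDistribution {n : ℕ} (C : Code n) : ℤ[X] :=
  1 + ∑ i ∈ Finset.Icc 1 n, (weightCount C i : ℤ[X]) * X ^ i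

/-- A `t`-weight code: exactly `t` of the numbers `A₁, …, Aₙ` are nonzero. -/
def IsWeightCode {n : ℕ} (t : ℕ) (C : Code n) : Prop :=
  ((Finset.Icc 1 n).filter fun i => weightCount C i ≠ 0).card = t

/-- The Griesmer sum `g(m, d) = ∑_{i=0}^{m-1} ⌈d / 2^i⌉`. The additive Griesmer bound for an
additive `[n, m/2, d]₄` code reads `3 n ≥ g(m, 2 d)`. -/
def griesmer (m d : ℕ) : ℕ := ∑ i ∈ Finset.range m, ⌈(d : ℚ) / 2 ^ i⌉₊

/-- Griesmer distance-optimal (GDO): `C` is an additive `[n, m/2, d]₄` code with `n - d` positive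
and `3 n < g(m, 2 d + 2)`. -/
def IsGDO {n : ℕ} (C : Code n) : Prop :=
  ∃ m d : ℕ, HasParams C ((m : ℝ) / 2) d ∧ d < n ∧ 3 * n < griesmer m (2 * d + 2)

/-- Griesmer puncture-optimal (GPO): `C` is an additive `[n, m/2, d]₄` code with `n - d` positive
and `3 n + 3 < g(m, 2 d + 2)`. -/
def IsGPO {n : ℕ} (C : Code n) : Prop :=
  ∃ m d : ℕ, HasParams C ((m : ℝ) / 2) d ∧ d < n ∧ 3 * n + 3 < griesmer m (2 * d + 2)

/-- `S` is an invariant subcode of `C` with parameters `[n, κ₂, δ₂]₄`: `C` is an `[n, κ₁, δ₁]₄` code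
with `δ₁ < δ₂`, and there is an `[n, κ₁ - κ₂, δ₁]₄` subcode `S₁` of `C`, meeting `S` only in `0`,
such that `δ₂` is the minimum of `weight (c₁ + c₂)` over nonzero `c₁ ∈ S₁` and nonzero `c₂ ∈ S`. -/
def IsInvariantSubcode {n : ℕ} (S C : Code n) (κ₂ : ℝ) (δ₂ : ℕ) : Prop :=
  ∃ (κ₁ : ℝ) (δ₁ : ℕ) (S₁ : Code n),
    HasParams C κ₁ δ₁ ∧ S₁ ≤ C ∧ S ≤ C ∧ Disjoint S₁ S ∧
    HasParams S₁ (κ₁ - κ₂) δ₁ ∧ HasParams S κ₂ δ₂ ∧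
    IsLeast {w : ℕ | ∃ c₁ ∈ S₁, c₁ ≠ 0 ∧ ∃ c₂ ∈ S, c₂ ≠ 0 ∧ weight (c₁ + c₂) = w} δ₂ ∧
    δ₁ < δ₂

end AdditiveCode

/-!
An additive quaternary code with `2 ^ k` words is the same thing as a system of `n` lines, possibly
degenerate, in the binary projective space of a `k`-dimensional space `V`: the codewords
correspond to the linear
functionals `H` on `V`, and the weight of the word of `H` is the number of lines on which `H` does
not vanish (`encode`). Such a functional takes the value one at exactly two points of a line, so
twice the weight is the number of points of the lines, with multiplicity, at which `H` is one
(`two_mul_weight_encode`).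

Suppose that the lines cover the points outside a `k₂`-dimensional subspace `U` once, except for a
point `P` outside `U`, which is covered three times (`IsLineCover`). Then `3 n = 2 ^ k - 2 ^ k₂ + 2`,
and the weight of the word of `H ≠ 0` is `2 ^ (k - 2) - 2 ^ (k₂ - 2)`, or `2 ^ (k - 2)` if `H`
vanishes on `U`, plus one if `H P = 1`. Counting the functionals in each of the four classes gives
the weight distribution. The words of the functionals with `H P = 0`, and the word of one functional
with `H P = 1` that does not vanish on `U`, give the invariant subcode (`IsLineCover.exists_code`).

To build the lines (`exists_line_cover`), take `V = W × F8` with `W` a vector space over the field of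
four elements `{0, 1, ω, 1 + ω}` and `F8` the field of eight elements, generated by `α`. Multiplying
by the nonzero elements `1, α, 1 + α` permutes `F8`, and multiplying by `1, ω, 1 + ω` permutes
the nonzero multiples of each `u ≠ 0` in `W` transitively. Hence the lines
`{(u, x), (ω u, α x), ((1 + ω) u, (1 + α) x)}`, for `x` in `F8` and one `u` from each point of `W`,
partition the points outside `0 × F8`, and those among them with `x = 0` and `u` in a subspace
partition the points of that subspace, which is taken as `U` and removed. The points of `0 × F8` form
a Fano plane, which is covered by the three lines through one of its points `P`.

The optimality claims follow from the value `2 ^ k - 2 ^ k₂ + k₂ + 1` of the Griesmer sum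
(`griesmer_add_two_pow`), to be compared with `3 n = 2 ^ k - 2 ^ k₂ + 2`.
-/

/-! ### The field with four elements -/

theorem F4.natCard : Nat.card F4 = 4 := by
  simpa using GaloisField.card 2 2 two_ne_zero

theorem F4.exists_ne_zero_ne_one : ∃ ω : F4, ω ≠ 0 ∧ ω ≠ 1 := by
  classical
  have := Fintype.ofFinite F4
  by_contra! h
  have hs : (Finset.univ : Finset F4) ⊆ {0, 1} := fun x _ => by
    by_cases hx : x = 0
    · simp [hx]
    · simp [h x hx]
  have h1 := Finset.card_le_card hs
  have h2 := Finset.card_le_two (a := (0 : F4)) (b := 1)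
  rw [Finset.card_univ, ← Nat.card_eq_fintype_card, F4.natCard] at h1
  omega

theorem F4.one_add_ne_zero {ω : F4} (h1 : ω ≠ 1) : 1 + ω ≠ 0 := fun h => h1 (by
  have := eq_neg_of_add_eq_zero_right h
  rwa [CharTwo.neg_eq] at this)

theorem F4.sum_units [Fintype F4ˣ] {ω : F4} (h0 : ω ≠ 0) (h1 : ω ≠ 1) (f : F4 → ℕ) :
    ∑ c : F4ˣ, f c = f 1 + f ω + f (1 + ω) := by
  classical
  have := Fintype.ofFinite F4
  have hω := F4.one_add_ne_zero h1
  have hU : (Finset.univ : Finset F4) = {0, 1, ω, 1 + ω} := by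
    symm
    apply Finset.eq_univ_of_card
    rw [← Nat.card_eq_fintype_card, F4.natCard, Finset.card_insert_of_notMem,
      Finset.card_insert_of_notMem, Finset.card_pair]
    · simp
    · simp [h1.symm, h0]
    · simp [h0.symm, hω.symm]
  have key : ∑ c : F4ˣ, f c + f 0 = ∑ c : F4, f c := by
    rw [← Finset.sum_erase_add _ _ (Finset.mem_univ (0 : F4))]
    congr 1
    refine Finset.sum_bij (fun c _ => (c : F4)) (by simp) (fun a _ b _ h => Units.ext h)
      (fun b hb => ⟨Units.mk0 b (Finset.ne_of_mem_erase hb), by simp, by simp⟩) (by simp)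
  rw [hU, Finset.sum_insert, Finset.sum_insert, Finset.sum_pair] at key
  · omega
  · simp
  · simp [h1.symm, h0]
  · simp [h0.symm, hω.symm]

open scoped LinearAlgebra.Projectivization in
/-- The multiples of the chosen representatives of the points of a projective space by the three
nonzero scalars `1, ω, 1 + ω` run once through the nonzero vectors. -/
theorem sum_projectivization_rep {W : Type*} [AddCommGroup W] [Module F4 W] [Fintype W]
    [Fintype (ℙ F4 W)] {ω : F4} (h0 : ω ≠ 0) (h1 : ω ≠ 1) (g : W → ℕ) :
    ∑ p : ℙ F4 W, (g p.rep + g (ω • p.rep) + g ((1 + ω) • p.rep)) + g 0 = ∑ w, g w := by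
  classical
  have := Fintype.ofFinite F4ˣ
  have h (p : ℙ F4 W) : g p.rep + g (ω • p.rep) + g ((1 + ω) • p.rep) =
      ∑ c : F4ˣ, g ((c : F4) • p.rep) := by
    rw [F4.sum_units h0 h1 fun c => g (c • p.rep), one_smul]
  simp_rw [h]
  rw [← Finset.sum_erase_add _ _ (Finset.mem_univ (0 : W)), ← Fintype.sum_prod_type']
  congr 1
  refine Finset.sum_bij (fun a _ => (a.2 : F4) • a.1.rep) ?_ ?_ ?_ (by simp)
  · rintro ⟨p, c⟩ -
    simp [p.rep_nonzero]
  · rintro ⟨p, c⟩ - ⟨p', c'⟩ - h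
    have hp : p = p' := by
      rw [← p.mk_rep, ← p'.mk_rep, Projectivization.mk_eq_mk_iff]
      refine ⟨c⁻¹ * c', ?_⟩
      rw [mul_smul, Units.smul_def c', ← h, ← Units.smul_def, inv_smul_smul]
    subst hp
    have := smul_left_injective F4 p.rep_nonzero h
    simpa using Units.ext this
  · intro w hw
    have hw := Finset.ne_of_mem_erase hw
    obtain ⟨c, hc⟩ := Projectivization.exists_smul_eq_mk_rep F4 w hw
    refine ⟨(Projectivization.mk F4 w hw, c⁻¹), by simp, ?_⟩
    simp only
    rw [← hc, ← Units.smul_def, inv_smul_smul]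

/-! ### A line system covering the complement of a subspace -/

/-- The three-dimensional space over the prime field, with coordinates relative to the basis
`1, α, α²` of the field with eight elements, where `α³ = α + 1`. -/
abbrev F8 : Type := ZMod 2 × ZMod 2 × ZMod 2

namespace F8

/-- Multiplication by `α`. -/
def mulAlpha (x : F8) : F8 := (x.2.2, x.1 + x.2.2, x.2.1)

theorem mulAlpha_bijective : Function.Bijective mulAlpha := by decide

/-- Multiplication by `1 + α = α³` is bijective as well. -/
theorem add_mulAlpha_bijective : Function.Bijective fun x => x + mulAlpha x := by decide

theorem mulAlpha_eq_zero : ∀ x, mulAlpha x = 0 ↔ x = 0 := by decide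

theorem add_mulAlpha_eq_zero : ∀ x, x + mulAlpha x = 0 ↔ x = 0 := by decide

/-- A fixed nonzero point. -/
def pt : F8 := (1, 0, 0)

/-- Together with `pt`, these points span the three lines through `pt`. -/
def dir : Fin 3 → F8 := ![(0, 1, 0), (0, 0, 1), (0, 1, 1)]

/-- The three lines through `pt` cover the Fano plane, and `pt` itself two extra times. -/
theorem sum_dir (f : F8 → ℕ) :
    ∑ i, (f pt + f (dir i) + f (pt + dir i)) + f 0 = ∑ x, f x + 2 * f pt := by
  have hz : ∀ g : ZMod 2 → ℕ, ∑ a, g a = g 0 + g 1 := fun g => Fin.sum_univ_two g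
  simp only [Fintype.sum_prod_type, hz, Fin.sum_univ_three, pt, dir, Matrix.cons_val_zero,
    Matrix.cons_val_one, Matrix.cons_val, Prod.mk_add_mk, add_zero, zero_add,
    show (0 : F8) = (0, 0, 0) from rfl]
  ring

end F8

open scoped LinearAlgebra.Projectivization in
/-- Let `U` be a subspace of the quaternary space `W`. The lines through `(u, x)` and `(ω u, α x)`,
for `u` running over representatives of the points of `W` and `x` over `F8` with `(u, x) ∉ U × 0`,
together with the three lines through `pt` in `0 × F8`, cover every nonzero point outside `U × 0`
exactly once, except for `pt`, which is covered three times. -/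
theorem exists_line_cover {W : Type*} [AddCommGroup W] [Module F4 W] [Fintype W]
    (U : Submodule F4 W) [DecidablePred (· ∈ U)] :
    ∃ (n : ℕ) (p q : Fin n → W × F8), ∀ f : W × F8 → ℕ,
      ∑ i, (f (p i) + f (q i) + f (p i + q i)) =
        ∑ v, (if v.1 ∈ U ∧ v.2 = 0 then 0 else f v) + 2 * f (0, F8.pt) := by
  classical
  have := Fintype.ofFinite (ℙ F4 W)
  obtain ⟨ω, h0, h1⟩ := F4.exists_ne_zero_ne_one
  have hω := F4.one_add_ne_zero h1
  let ι : Type _ := {a : ℙ F4 W × F8 // ¬ (a.1.rep ∈ U ∧ a.2 = 0)} ⊕ Fin 3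
  let e : Fin (Fintype.card ι) ≃ ι := (Fintype.equivFin ι).symm
  let p : ι → W × F8 := Sum.elim (fun a => (a.1.1.rep, a.1.2)) fun _ => (0, F8.pt)
  let q : ι → W × F8 :=
    Sum.elim (fun a => (ω • a.1.1.rep, F8.mulAlpha a.1.2)) fun j => (0, F8.dir j)
  refine ⟨Fintype.card ι, p ∘ e, q ∘ e, fun f => ?_⟩
  simp only [Function.comp_apply]
  rw [e.sum_comp fun i => f (p i) + f (q i) + f (p i + q i), Fintype.sum_sum_type]
  simp only [p, q, Sum.elim_inl, Sum.elim_inr, Prod.mk_add_mk, add_zero]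
  -- `g` is `f` with the points of the removed subspace `U × 0` discarded.
  set g : W × F8 → ℕ := fun v => if v.1 ∈ U ∧ v.2 = 0 then 0 else f v with hg
  have hmem {c : F4} (hc : c ≠ 0) (w : W) : c • w ∈ U ↔ w ∈ U := U.smul_mem_iff hc
  have hA : ∑ a : {a : ℙ F4 W × F8 // ¬ (a.1.rep ∈ U ∧ a.2 = 0)},
      (f (a.1.1.rep, a.1.2) + f (ω • a.1.1.rep, F8.mulAlpha a.1.2) +
        f (a.1.1.rep + ω • a.1.1.rep, a.1.2 + F8.mulAlpha a.1.2)) =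
      ∑ a : ℙ F4 W × F8, (g (a.1.rep, a.2) + g (ω • a.1.rep, F8.mulAlpha a.2) +
        g ((1 + ω) • a.1.rep, a.2 + F8.mulAlpha a.2)) := by
    rw [← Finset.sum_subtype
      (Finset.univ.filter fun a : ℙ F4 W × F8 => ¬ (a.1.rep ∈ U ∧ a.2 = 0)) (by simp)
      fun a => f (a.1.rep, a.2) + f (ω • a.1.rep, F8.mulAlpha a.2) +
        f (a.1.rep + ω • a.1.rep, a.2 + F8.mulAlpha a.2), Finset.sum_filter]
    refine Finset.sum_congr rfl fun a _ => ?_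
    simp only [hg, hmem h0, hmem hω, F8.mulAlpha_eq_zero, F8.add_mulAlpha_eq_zero]
    split_ifs with h
    · rfl
    · rw [add_smul, one_smul]
  have hB : ∑ a : ℙ F4 W × F8, (g (a.1.rep, a.2) + g (ω • a.1.rep, F8.mulAlpha a.2) +
        g ((1 + ω) • a.1.rep, a.2 + F8.mulAlpha a.2)) + ∑ x, g (0, x) = ∑ v, g v := by
    rw [Fintype.sum_prod_type (f := g), Finset.sum_comm, Fintype.sum_prod_type]
    simp_rw [← sum_projectivization_rep h0 h1 fun w => g (w, _)]
    rw [Finset.sum_add_distrib, Finset.sum_comm (γ := F8)]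
    congr 1
    refine Finset.sum_congr rfl fun a _ => ?_
    simp only [Finset.sum_add_distrib]
    rw [F8.mulAlpha_bijective.sum_comp fun x => g (ω • a.rep, x),
      F8.add_mulAlpha_bijective.sum_comp fun x => g ((1 + ω) • a.rep, x)]
  have hC : ∑ x, g (0, x) + f (0, 0) = ∑ x, f (0, x) := by
    rw [← Finset.sum_erase_add _ _ (Finset.mem_univ (0 : F8)),
      ← Finset.sum_erase_add (a := (0 : F8)) _ (fun x => f (0, x)) (Finset.mem_univ _)]
    have : ∑ x ∈ Finset.univ.erase (0 : F8), g (0, x) = ∑ x ∈ Finset.univ.erase (0 : F8), f (0, x) :=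
      Finset.sum_congr rfl fun x hx => by simp [hg, Finset.ne_of_mem_erase hx]
    rw [this]
    simp [hg]
  have hD := F8.sum_dir fun x => f (0, x)
  rw [hA]
  change _ = ∑ v, g v + _
  omega

/-! ### Counting with linear functionals over the prime field -/

theorem ZMod.two_eq_zero_or_eq_one : ∀ a : ZMod 2, a = 0 ∨ a = 1 := by decide

/-- A nonzero functional takes the value one on exactly half of the space. -/
theorem two_mul_sum_val {M : Type*} [AddCommGroup M] [Module (ZMod 2) M] [Fintype M]
    {φ : Module.Dual (ZMod 2) M} (hφ : φ ≠ 0) : 2 * ∑ v, (φ v).val = Fintype.card M := by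
  obtain ⟨v₀, hv₀⟩ : ∃ v, φ v ≠ 0 := by
    by_contra! h
    exact hφ (LinearMap.ext h)
  have h1 : φ v₀ = 1 := (ZMod.two_eq_zero_or_eq_one _).resolve_left hv₀
  have hflip : ∀ a : ZMod 2, a.val + (a + 1).val = 1 := by decide
  calc 2 * ∑ v, (φ v).val = ∑ v, (φ v).val + ∑ v, (φ (v + v₀)).val := by
        rw [two_mul, ← Equiv.sum_comp (Equiv.addRight v₀) fun v => (φ v).val]
        rfl
    _ = ∑ v : M, 1 := by
        rw [← Finset.sum_add_distrib]
        exact Finset.sum_congr rfl fun v _ => by rw [map_add, h1, hflip]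
    _ = Fintype.card M := by simp

theorem card_mul_card_dualAnnihilator {V : Type*} [AddCommGroup V] [Module (ZMod 2) V] [Finite V]
    (U : Submodule (ZMod 2) V) : Nat.card U * Nat.card U.dualAnnihilator = Nat.card V := by
  rw [Module.natCard_eq_pow_finrank (K := ZMod 2) (V := U),
    Module.natCard_eq_pow_finrank (K := ZMod 2) (V := U.dualAnnihilator),
    Module.natCard_eq_pow_finrank (K := ZMod 2) (V := V), ← pow_add,
    Subspace.finrank_add_finrank_dualAnnihilator_eq]

theorem natCard_dual (V : Type*) [AddCommGroup V] [Module (ZMod 2) V] [Finite V] :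
    Nat.card (Module.Dual (ZMod 2) V) = Nat.card V := by
  rw [Module.natCard_eq_pow_finrank (K := ZMod 2) (V := V),
    Module.natCard_eq_pow_finrank (K := ZMod 2) (V := Module.Dual (ZMod 2) V),
    Subspace.dual_finrank_eq]

section LineCode

variable {V : Type*} [AddCommGroup V] [Module (ZMod 2) V]

instance [Finite V] : Finite (Module.Dual (ZMod 2) V) :=
  Finite.of_injective (fun φ v => φ v) fun _ _ h => LinearMap.ext (congrFun h)

open Classical in
theorem two_mul_card_dualAnnihilator_eval_eq_one [Fintype V]
    [Fintype (Module.Dual (ZMod 2) V)] (U : Submodule (ZMod 2) V) {P : V} (hP : P ∉ U) :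
    2 * (Finset.univ.filter fun H : Module.Dual (ZMod 2) V =>
      H ∈ U.dualAnnihilator ∧ H P = 1).card = Nat.card U.dualAnnihilator := by
  obtain ⟨f, hf, hU⟩ := Submodule.exists_le_ker_of_notMem hP
  let φ : Module.Dual (ZMod 2) U.dualAnnihilator :=
    (Module.Dual.eval (ZMod 2) V P).comp U.dualAnnihilator.subtype
  have hφ : φ ≠ 0 := fun h => hf (by
    have hfU : f ∈ U.dualAnnihilator := (Submodule.mem_dualAnnihilator f).2 fun u hu => hU hu
    simpa [φ] using LinearMap.congr_fun h ⟨f, hfU⟩)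
  have hval : ∀ a : ZMod 2, a.val = if a = 1 then 1 else 0 := by decide
  have hsub : ∑ a, (φ a).val = ∑ a : U.dualAnnihilator, (a.1 P).val := rfl
  rw [Nat.card_eq_fintype_card, ← two_mul_sum_val hφ, hsub, Finset.card_filter,
    ← Finset.sum_subtype (Finset.univ.filter fun H => H ∈ U.dualAnnihilator) (by simp)
      fun H : Module.Dual (ZMod 2) V => (H P).val, Finset.sum_filter]
  simp_rw [hval, ite_and]

/-! ### The code of a system of lines -/

/-- The additive code map of the lines spanned by `p i` and `q i`: a functional `H` on the binary
space `V` is sent to the word whose coordinates record the restrictions of `H` to these lines. -/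
noncomputable def encode {n : ℕ} (ω : F4) (p q : Fin n → V) :
    Module.Dual (ZMod 2) V →+ (Fin n → F4) where
  toFun H i := algebraMap (ZMod 2) F4 (H (p i)) + algebraMap (ZMod 2) F4 (H (q i)) * ω
  map_zero' := by ext i; simp
  map_add' H K := by ext i; simp; ring

/-- A functional that does not vanish on a line is one at exactly two of its points. -/
theorem two_mul_weight_encode {n : ℕ} {ω : F4} (h0 : ω ≠ 0) (h1 : ω ≠ 1) (p q : Fin n → V)
    (H : Module.Dual (ZMod 2) V) : 2 * AdditiveCode.weight (encode ω p q H) =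
      ∑ i, ((H (p i)).val + (H (q i)).val + (H (p i + q i)).val) := by
  have hω := F4.one_add_ne_zero h1
  classical
  rw [AdditiveCode.weight, hammingNorm, Finset.card_filter, Finset.mul_sum]
  refine Finset.sum_congr rfl fun i _ => ?_
  rw [map_add]
  simp only [encode, AddMonoidHom.coe_mk, ZeroHom.coe_mk]
  have h11 : (1 + 1 : ZMod 2) = 0 := by decide
  rcases ZMod.two_eq_zero_or_eq_one (H (p i)) with a | a <;>
  rcases ZMod.two_eq_zero_or_eq_one (H (q i)) with b | b <;>
  simp [a, b, h0, hω, h11, ZMod.val_one]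

variable [Fintype V] (U : Submodule (ZMod 2) V) (P : V)

open Classical in
/-- Multiplicity condition on the lines through `p i`, `q i`: together they cover every point
outside `U` once and `P` two more times. It is stated through arbitrary weight functions `f`. -/
def IsLineCover {n : ℕ} (p q : Fin n → V) : Prop :=
  ∀ f : V → ℕ, ∑ i, (f (p i) + f (q i) + f (p i + q i)) =
    ∑ v, (if v ∈ U then 0 else f v) + 2 * f P

variable {U P}

theorem IsLineCover.three_mul_add_card {n : ℕ} {p q : Fin n → V} (h : IsLineCover U P p q) :
    3 * n + Nat.card U = Nat.card V + 2 := by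
  classical
  have := h fun _ => 1
  simp only [Finset.sum_const, Finset.card_univ, Fintype.card_fin, smul_eq_mul] at this
  have h2 : ∑ v : V, (if v ∈ U then 0 else 1) + Nat.card U = Nat.card V := by
    rw [Nat.card_eq_fintype_card, Nat.card_eq_fintype_card,
      Fintype.card_of_subtype (Finset.univ.filter (· ∈ U)) (by simp), Finset.card_filter,
      ← Finset.sum_add_distrib, Fintype.card_eq_sum_ones]
    refine Finset.sum_congr rfl fun v _ => ?_
    split_ifs <;> rfl
  omega

open Classical in
/-- The weight of the codeword of `H` depends only on whether `H` vanishes on `U` and at `P`. -/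
theorem IsLineCover.four_mul_weight_encode {n : ℕ} {p q : Fin n → V} (h : IsLineCover U P p q)
    {ω : F4} (h0 : ω ≠ 0) (h1 : ω ≠ 1) {H : Module.Dual (ZMod 2) V} (hH : H ≠ 0) :
    4 * AdditiveCode.weight (encode ω p q H) +
      (if H ∈ U.dualAnnihilator then 0 else Nat.card U) = Nat.card V + 4 * (H P).val := by
  have h2 := two_mul_weight_encode h0 h1 p q H
  rw [h fun v => (H v).val] at h2
  have hV := two_mul_sum_val hH
  rw [← Nat.card_eq_fintype_card] at hV
  have hsplit : ∑ v, (if v ∈ U then 0 else (H v).val) + ∑ u : U, (H u).val =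
      ∑ v, (H v).val := by
    rw [← Finset.sum_subtype (Finset.univ.filter (· ∈ U)) (by simp) fun v => (H v).val,
      Finset.sum_filter, ← Finset.sum_add_distrib]
    refine Finset.sum_congr rfl fun v _ => ?_
    split_ifs <;> simp
  have hU : 2 * ∑ u : U, (H u).val = if H ∈ U.dualAnnihilator then 0 else Nat.card U := by
    split_ifs with hm
    · rw [Submodule.mem_dualAnnihilator] at hm
      simp [hm]
    · have hne : H.comp U.subtype ≠ 0 := fun hz => hm <|
        (Submodule.mem_dualAnnihilator H).2 fun u hu => LinearMap.congr_fun hz ⟨u, hu⟩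
      rw [Nat.card_eq_fintype_card, ← two_mul_sum_val hne]
      simp
  omega

end LineCode

/-! ### Weight distributions -/

/-- The weight distribution of the image of an injective code map, as a sum over the messages. -/
theorem weightDistribution_range {n : ℕ} {D : Type*} [AddCommGroup D] [Fintype D]
    (E : D →+ (Fin n → F4)) (hE : Function.Injective E) :
    AdditiveCode.weightDistribution E.range = ∑ x, (X : ℤ[X]) ^ AdditiveCode.weight (E x) := by
  classical
  have hcount (i : ℕ) : AdditiveCode.weightCount E.range i =
      (Finset.univ.filter fun x => AdditiveCode.weight (E x) = i).card := by
    rw [AdditiveCode.weightCount, ← Finset.card_image_of_injective _ hE,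
      ← Set.ncard_coe_finset]
    congr 1
    ext c
    simp only [AddMonoidHom.mem_range, Set.mem_ofPred_eq, Finset.coe_image, Finset.coe_filter,
      Finset.mem_univ, true_and, Set.mem_image]
    constructor
    · rintro ⟨⟨x, rfl⟩, hx⟩
      exact ⟨x, hx, rfl⟩
    · rintro ⟨x, hx, rfl⟩
      exact ⟨⟨x, rfl⟩, hx⟩
  have hzero : (Finset.univ.filter fun x => AdditiveCode.weight (E x) = 0) = {0} := by
    ext x
    simp [AdditiveCode.weight, hammingNorm_eq_zero, map_eq_zero_iff E hE]
  have hle (x : D) : AdditiveCode.weight (E x) ∈ Finset.range (n + 1) := by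
    rw [Finset.mem_range, Nat.lt_succ_iff]
    simpa [AdditiveCode.weight] using hammingNorm_le_card_fintype (x := E x)
  rw [← Finset.sum_fiberwise_of_maps_to (fun x _ => hle x), Finset.range_eq_Ico,
    Finset.sum_eq_sum_Ico_succ_bot (Nat.succ_pos n), hzero, AdditiveCode.weightDistribution]
  have h00 : AdditiveCode.weight (E 0) = 0 := by simp [AdditiveCode.weight]
  rw [Finset.sum_singleton, h00, pow_zero]
  congr 1
  refine Finset.sum_congr rfl fun i _ => ?_
  rw [hcount, Finset.sum_congr rfl fun x hx => by rw [(Finset.mem_filter.1 hx).2],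
    Finset.sum_const, nsmul_eq_mul]

theorem dim_eq_half {n m : ℕ} {C : AdditiveCode.Code n} (h : Nat.card C = 2 ^ m) :
    AdditiveCode.dim C = (m : ℝ) / 2 := by
  have h4 : Real.log 4 = 2 * Real.log 2 := by
    rw [show (4 : ℝ) = 2 ^ 2 by norm_num, Real.log_pow]; norm_num
  have := Real.log_pos one_lt_two
  rw [AdditiveCode.dim, h, Real.logb, h4]
  push_cast
  rw [Real.log_pow]
  field_simp

/-! ### Griesmer sums -/

theorem ceil_div_two_pow_eq {D i t : ℕ} (h1 : D ≤ t * 2 ^ i) (h2 : t * 2 ^ i < D + 2 ^ i) :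
    ⌈(D : ℚ) / 2 ^ i⌉₊ = t := by
  have hp : (0 : ℚ) < 2 ^ i := by positivity
  apply le_antisymm
  · rw [Nat.ceil_le, div_le_iff₀ hp]
    exact_mod_cast h1
  · obtain _ | s := t
    · exact Nat.zero_le _
    · rw [Nat.succ_le_iff, Nat.lt_ceil, lt_div_iff₀ hp]
      have : s * 2 ^ i < D := by rw [Nat.succ_mul] at h2; omega
      exact_mod_cast this

theorem sum_range_two_pow_sub (m : ℕ) : ∑ i ∈ Finset.range m, 2 ^ (m - 1 - i) + 1 = 2 ^ m := by
  rw [Finset.sum_range_reflect (fun i => 2 ^ i) m, Nat.geomSum_eq le_rfl]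
  have := Nat.one_le_two_pow (n := m)
  omega

/-- The Griesmer sum of twice the distance `2 ^ (k - 2) - 2 ^ (k₂ - 2) + 1`. Each of the first `k₂`
summands is rounded up, which accounts for the term `k₂`. -/
theorem griesmer_add_two_pow {k k₂ : ℕ} (hk₂ : 2 ≤ k₂) (hk : k₂ < k) :
    AdditiveCode.griesmer k (2 * (2 ^ (k - 2) - 2 ^ (k₂ - 2)) + 2) + 2 ^ k₂ =
      2 ^ k + k₂ + 1 := by
  set D := 2 * (2 ^ (k - 2) - 2 ^ (k₂ - 2)) + 2 with hD
  have e1 : 2 ^ (k - 1) = 2 * 2 ^ (k - 2) := by rw [← pow_succ']; congr 1; omega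
  have e2 : 2 ^ (k₂ - 1) = 2 * 2 ^ (k₂ - 2) := by rw [← pow_succ']; congr 1; omega
  have hlt : 2 ^ (k₂ - 2) < 2 ^ (k - 2) := Nat.pow_lt_pow_right (by norm_num) (by omega)
  have hpos := Nat.one_le_two_pow (n := k₂ - 2)
  have hD' : D + 2 ^ (k₂ - 1) = 2 ^ (k - 1) + 2 := by omega
  have hterm (i : ℕ) (hi : i < k) :
      ⌈(D : ℚ) / 2 ^ i⌉₊ + (if i < k₂ then 2 ^ (k₂ - 1 - i) else 0) =
        2 ^ (k - 1 - i) + (if i < k₂ then 1 else 0) + (if i = 0 then 1 else 0) := by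
    have a1 : 2 ^ (k - 1 - i) * 2 ^ i = 2 ^ (k - 1) := by rw [← pow_add]; congr 1; omega
    by_cases hik : i < k₂
    · have a2 : 2 ^ (k₂ - 1 - i) * 2 ^ i = 2 ^ (k₂ - 1) := by rw [← pow_add]; congr 1; omega
      have hle : 2 ^ (k₂ - 1 - i) ≤ 2 ^ (k - 1 - i) := Nat.pow_le_pow_right (by norm_num) (by omega)
      obtain ⟨t, ht⟩ := Nat.exists_eq_add_of_le hle
      rw [ht, add_mul, a2] at a1
      rcases Nat.eq_zero_or_pos i with rfl | hi0
      · rw [ceil_div_two_pow_eq (t := t + 2) (by omega) (by omega), ht]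
        simp [hik]
        omega
      · have h2i : 2 ≤ 2 ^ i := by simpa using Nat.pow_le_pow_right (n := 2) (by norm_num) hi0
        rw [ceil_div_two_pow_eq (t := t + 1) (by rw [add_mul]; omega) (by rw [add_mul]; omega), ht]
        simp [hik, hi0.ne']
        omega
    · have h2i : 2 ^ k₂ ≤ 2 ^ i := Nat.pow_le_pow_right (by norm_num) (by omega)
      have e3 : 2 ^ k₂ = 2 * 2 ^ (k₂ - 1) := by rw [← pow_succ']; congr 1; omega
      rw [ceil_div_two_pow_eq (t := 2 ^ (k - 1 - i)) (by omega) (by omega)]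
      have : i ≠ 0 := by omega
      simp [hik, this]
  have hsum := Finset.sum_congr rfl fun i (hi : i ∈ Finset.range k) => hterm i (Finset.mem_range.1 hi)
  have hfil : (Finset.range k).filter (· < k₂) = Finset.range k₂ := by
    ext i
    simp only [Finset.mem_filter, Finset.mem_range]
    omega
  simp only [Finset.sum_add_distrib, ← Finset.sum_filter, hfil] at hsum
  have g1 := sum_range_two_pow_sub k
  have g2 := sum_range_two_pow_sub k₂
  have g3 : ((Finset.range k).filter (· = 0)).card = 1 := by
    rw [Finset.card_eq_one]
    exact ⟨0, by ext i; simp only [Finset.mem_filter, Finset.mem_range, Finset.mem_singleton]; omega⟩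
  simp only [Finset.sum_const, smul_eq_mul, mul_one, Finset.card_range, g3] at hsum
  rw [AdditiveCode.griesmer]
  omega

/-! ### The code of a line cover -/

section CoverCode

variable {V : Type*} [AddCommGroup V] [Module (ZMod 2) V] [Fintype V]
  {U : Submodule (ZMod 2) V} {P : V}

open Classical in
/-- The sizes of the four classes of functionals, by vanishing on `U` and at `P ∉ U`. -/
theorem card_functional_classes [Fintype (Module.Dual (ZMod 2) V)] {k k₂ : ℕ} (hk : k₂ < k)
    (hV : Nat.card V = 2 ^ k) (hU : Nat.card U = 2 ^ k₂) (hP : P ∉ U) :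
    (Finset.univ.filter fun H : Module.Dual (ZMod 2) V =>
        H ∈ U.dualAnnihilator ∧ H P = 0).card = 2 ^ (k - k₂ - 1) ∧
      (Finset.univ.filter fun H : Module.Dual (ZMod 2) V =>
        H ∈ U.dualAnnihilator ∧ H P = 1).card = 2 ^ (k - k₂ - 1) ∧
      (Finset.univ.filter fun H : Module.Dual (ZMod 2) V =>
        H ∉ U.dualAnnihilator ∧ H P = 0).card + 2 ^ (k - k₂ - 1) = 2 ^ (k - 1) ∧
      (Finset.univ.filter fun H : Module.Dual (ZMod 2) V =>
        H ∉ U.dualAnnihilator ∧ H P = 1).card + 2 ^ (k - k₂ - 1) = 2 ^ (k - 1) ∧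
      (Finset.univ.filter fun H : Module.Dual (ZMod 2) V => H P = 0).card = 2 ^ (k - 1) := by
  have hA : Nat.card U.dualAnnihilator = 2 ^ (k - k₂) := by
    have := card_mul_card_dualAnnihilator U
    rw [hV, hU, show 2 ^ k = 2 ^ k₂ * 2 ^ (k - k₂) by rw [← pow_add]; congr 1; omega] at this
    exact Nat.eq_of_mul_eq_mul_left (by positivity) this
  have hP0 : P ∉ (⊥ : Submodule (ZMod 2) V) := fun h => hP (by
    rw [Submodule.mem_bot] at h
    simp [h])
  have h1 := two_mul_card_dualAnnihilator_eval_eq_one U hP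
  have h2 := two_mul_card_dualAnnihilator_eval_eq_one ⊥ hP0
  have hbot : Nat.card (⊥ : Submodule (ZMod 2) V).dualAnnihilator = 2 ^ k := by
    have := card_mul_card_dualAnnihilator (⊥ : Submodule (ZMod 2) V)
    rwa [Nat.card_unique, one_mul, hV] at this
  have e1 : 2 ^ (k - k₂) = 2 * 2 ^ (k - k₂ - 1) := by rw [← pow_succ']; congr 1; omega
  have e2 : 2 ^ k = 2 * 2 ^ (k - 1) := by rw [← pow_succ']; congr 1; omega
  rw [hA] at h1
  rw [hbot] at h2
  simp only [Submodule.dualAnnihilator_bot, Submodule.mem_top, true_and] at h2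
  have hcA : (Finset.univ.filter fun H : Module.Dual (ZMod 2) V =>
      H ∈ U.dualAnnihilator).card = 2 ^ (k - k₂) := by
    rw [← hA, Nat.card_eq_fintype_card]
    exact (Fintype.card_of_subtype _ (by simp)).symm
  have hcD : (Finset.univ : Finset (Module.Dual (ZMod 2) V)).card = 2 ^ k := by
    rw [← hV, ← natCard_dual V, Nat.card_eq_fintype_card, Finset.card_univ]
  have hne (H : Module.Dual (ZMod 2) V) : H P = 0 ↔ ¬ H P = 1 := by
    rcases ZMod.two_eq_zero_or_eq_one (H P) with h | h <;> simp [h]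
  have s1 := Finset.card_filter_add_card_filter_not
    (s := Finset.univ.filter fun H : Module.Dual (ZMod 2) V => H ∈ U.dualAnnihilator)
    (fun H => H P = 1)
  have s2 := Finset.card_filter_add_card_filter_not
    (s := (Finset.univ : Finset (Module.Dual (ZMod 2) V))) (fun H => H P = 1)
  have s3 := Finset.card_filter_add_card_filter_not
    (s := Finset.univ.filter fun H : Module.Dual (ZMod 2) V => H P = 1)
    (fun H => H ∈ U.dualAnnihilator)
  have s4 := Finset.card_filter_add_card_filter_not
    (s := Finset.univ.filter fun H : Module.Dual (ZMod 2) V => ¬ H P = 1)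
    (fun H => H ∈ U.dualAnnihilator)
  simp only [Finset.filter_filter] at s1 s3 s4
  simp only [hne]
  simp only [and_comm (b := _ ∈ U.dualAnnihilator), and_comm (b := _ ∉ U.dualAnnihilator)]
    at s3 s4
  omega

/-- The weights occurring in the code of a line cover. -/
theorem IsLineCover.weight_encode {n k k₂ : ℕ} {p q : Fin n → V} (h : IsLineCover U P p q)
    {ω : F4} (h0 : ω ≠ 0) (h1 : ω ≠ 1) (hk₂ : 2 ≤ k₂) (hk : k₂ < k) (hV : Nat.card V = 2 ^ k)
    (hU : Nat.card U = 2 ^ k₂) {H : Module.Dual (ZMod 2) V} (hH : H ≠ 0) :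
    (H ∈ U.dualAnnihilator → AdditiveCode.weight (encode ω p q H) = 2 ^ (k - 2) + (H P).val) ∧
    (H ∉ U.dualAnnihilator → AdditiveCode.weight (encode ω p q H) =
      2 ^ (k - 2) - 2 ^ (k₂ - 2) + (H P).val) := by
  have := h.four_mul_weight_encode h0 h1 hH
  have e1 : 2 ^ k = 4 * 2 ^ (k - 2) := by
    rw [show 4 = 2 ^ 2 by norm_num, ← pow_add]; congr 1; omega
  have e2 : 2 ^ k₂ = 4 * 2 ^ (k₂ - 2) := by
    rw [show 4 = 2 ^ 2 by norm_num, ← pow_add]; congr 1; omega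
  have hlt : 2 ^ (k₂ - 2) < 2 ^ (k - 2) := Nat.pow_lt_pow_right (by norm_num) (by omega)
  rw [hV, hU] at this
  constructor <;> intro hA <;> simp only [hA, if_true, if_false] at this <;> omega

/-- The code of a line cover has the asserted parameters, weight distribution and invariant
subcode. The subcode is generated by the word of a functional `K` with `K P = 1` that does not
vanish on `U`, and its complement consists of the words of the functionals vanishing at `P`. -/
theorem IsLineCover.exists_code {n k k₂ : ℕ} {p q : Fin n → V} (h : IsLineCover U P p q)
    (hk₂ : 4 ≤ k₂) (hk : k₂ + 3 ≤ k) (hV : Nat.card V = 2 ^ k) (hU : Nat.card U = 2 ^ k₂)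
    (hP : P ∉ U) {d : ℕ} (hd : d = 2 ^ (k - 2) - 2 ^ (k₂ - 2)) :
    ∃ C : AdditiveCode.Code n,
        AdditiveCode.HasParams C ((k : ℝ) / 2) d ∧
        AdditiveCode.IsWeightCode 4 C ∧
        AdditiveCode.weightDistribution C =
          1 + (2 ^ (k - 1) - 2 ^ (k - k₂ - 1)) * X ^ d
            + (2 ^ (k - 1) - 2 ^ (k - k₂ - 1)) * X ^ (d + 1)
            + (2 ^ (k - k₂ - 1) - 1) * X ^ (2 ^ (k - 2))
            + 2 ^ (k - k₂ - 1) * X ^ (2 ^ (k - 2) + 1) ∧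
        ∃ S : AdditiveCode.Code n, AdditiveCode.IsInvariantSubcode S C (1 / 2) (d + 1) := by
  classical
  have := Fintype.ofFinite (Module.Dual (ZMod 2) V)
  obtain ⟨ω, h0, h1⟩ := F4.exists_ne_zero_ne_one
  set E := encode ω p q with hEdef
  have hw {H : Module.Dual (ZMod 2) V} (hH : H ≠ 0) :=
    h.weight_encode h0 h1 (by omega) (by omega) hV hU hH
  rw [← hd, ← hEdef] at hw
  obtain ⟨cA0, cA1, cB0, cB1, cP⟩ := card_functional_classes (by omega) hV hU hP
  have hb4 : 4 ≤ 2 ^ (k₂ - 2) := by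
    simpa using Nat.pow_le_pow_right (n := 2) (by norm_num) (by omega : 2 ≤ k₂ - 2)
  have hba : 2 * 2 ^ (k₂ - 2) ≤ 2 ^ (k - 2) := by
    rw [← pow_succ']; exact Nat.pow_le_pow_right (by norm_num) (by omega)
  have hc4 : 4 ≤ 2 ^ (k - k₂ - 1) := by
    simpa using Nat.pow_le_pow_right (n := 2) (by norm_num) (by omega : 2 ≤ k - k₂ - 1)
  have hck : 2 * 2 ^ (k - k₂ - 1) ≤ 2 ^ (k - 1) := by
    rw [← pow_succ']; exact Nat.pow_le_pow_right (by norm_num) (by omega)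
  have hdb : d + 2 ^ (k₂ - 2) = 2 ^ (k - 2) := by omega
  have hval0 : (0 : ZMod 2).val = 0 := rfl
  have hval1 : (1 : ZMod 2).val = 1 := rfl
  have hE0 : AdditiveCode.weight (E 0) = 0 := by simp [AdditiveCode.weight]
  have hcases {H : Module.Dual (ZMod 2) V} (hH : H ≠ 0) : d ≤ AdditiveCode.weight (E H) := by
    by_cases hA : H ∈ U.dualAnnihilator
    · rw [(hw hH).1 hA]; omega
    · rw [(hw hH).2 hA]; omega
  have hE : Function.Injective E := by
    rw [injective_iff_map_eq_zero]
    intro H hz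
    by_contra hH
    have := hcases hH
    rw [hz, ← map_zero E, hE0] at this
    omega
  have hEne {H : Module.Dual (ZMod 2) V} : E H ≠ 0 ↔ H ≠ 0 := by rw [Ne, map_eq_zero_iff E hE]
  have ex {Q : Module.Dual (ZMod 2) V → Prop} [DecidablePred Q]
      (hc : 1 < (Finset.univ.filter Q).card) :
      ∀ K, ∃ H, Q H ∧ H ≠ K := fun K => by
    obtain ⟨H, hH, hne⟩ := Finset.exists_mem_ne hc K
    exact ⟨H, (Finset.mem_filter.1 hH).2, hne⟩
  obtain ⟨HA0, ⟨hA0, hA0P⟩, hA0n⟩ := ex (by omega : 1 < (Finset.univ.filter fun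
    H : Module.Dual (ZMod 2) V => H ∈ U.dualAnnihilator ∧ H P = 0).card) 0
  obtain ⟨HA1, ⟨hA1, hA1P⟩, hA1n⟩ := ex (by omega : 1 < (Finset.univ.filter fun
    H : Module.Dual (ZMod 2) V => H ∈ U.dualAnnihilator ∧ H P = 1).card) 0
  obtain ⟨HB0, ⟨hB0, hB0P⟩, hB0n⟩ := ex (by omega : 1 < (Finset.univ.filter fun
    H : Module.Dual (ZMod 2) V => H ∉ U.dualAnnihilator ∧ H P = 0).card) 0
  have exB1 := ex (by omega : 1 < (Finset.univ.filter fun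
    H : Module.Dual (ZMod 2) V => H ∉ U.dualAnnihilator ∧ H P = 1).card)
  obtain ⟨K, ⟨hK, hKP⟩, hKn⟩ := exB1 0
  obtain ⟨L, ⟨hL, hLP⟩, hLK⟩ := exB1 K
  have wA0 : AdditiveCode.weight (E HA0) = 2 ^ (k - 2) := by
    rw [(hw hA0n).1 hA0, hA0P, hval0, add_zero]
  have wA1 : AdditiveCode.weight (E HA1) = 2 ^ (k - 2) + 1 := by
    rw [(hw hA1n).1 hA1, hA1P, hval1]
  have wB0 : AdditiveCode.weight (E HB0) = d := by rw [(hw hB0n).2 hB0, hB0P, hval0, add_zero]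
  have wK : AdditiveCode.weight (E K) = d + 1 := by rw [(hw hKn).2 hK, hKP, hval1]
  have hparams : AdditiveCode.HasParams E.range ((k : ℝ) / 2) d := by
    refine ⟨dim_eq_half ?_, ⟨E HB0, ⟨HB0, rfl⟩, hEne.2 hB0n, wB0⟩, ?_⟩
    · rw [← hV, ← natCard_dual V]
      exact Nat.card_congr (E.ofInjective hE).toEquiv.symm
    · rintro _ ⟨_, ⟨H, rfl⟩, hH, rfl⟩
      exact hcases (hEne.1 hH)
  refine ⟨E.range, hparams, ?_, ?_, ?_⟩
  · have hcount (i : ℕ) : AdditiveCode.weightCount E.range i ≠ 0 ↔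
        ∃ H, AdditiveCode.weight (E H) = i := by
      rw [AdditiveCode.weightCount, Ne, Set.ncard_eq_zero (Set.toFinite _), ← Ne,
        ← Set.nonempty_iff_ne_empty]
      constructor
      · rintro ⟨_, ⟨H, rfl⟩, hi⟩
        exact ⟨H, hi⟩
      · rintro ⟨H, hi⟩
        exact ⟨_, ⟨H, rfl⟩, hi⟩
    have hset : ((Finset.Icc 1 n).filter fun i => AdditiveCode.weightCount E.range i ≠ 0) =
        {d, d + 1, 2 ^ (k - 2), 2 ^ (k - 2) + 1} := by
      ext i
      simp only [Finset.mem_filter, hcount, Finset.mem_Icc, Finset.mem_insert,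
        Finset.mem_singleton]
      constructor
      · rintro ⟨⟨hi, -⟩, H, rfl⟩
        have hH : H ≠ 0 := by
          rintro rfl
          omega
        have hlt := ZMod.val_lt (H P)
        by_cases hA : H ∈ U.dualAnnihilator
        · have := (hw hH).1 hA
          omega
        · have := (hw hH).2 hA
          omega
      · intro hi
        have hex : ∃ H, AdditiveCode.weight (E H) = i := by
          rcases hi with rfl | rfl | rfl | rfl
          exacts [⟨_, wB0⟩, ⟨_, wK⟩, ⟨_, wA0⟩, ⟨_, wA1⟩]
        refine ⟨⟨by omega, ?_⟩, hex⟩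
        obtain ⟨H, rfl⟩ := hex
        simpa [AdditiveCode.weight] using hammingNorm_le_card_fintype (x := E H)
    rw [AdditiveCode.IsWeightCode, hset, Finset.card_insert_of_notMem,
      Finset.card_insert_of_notMem, Finset.card_pair]
    · omega
    · simp only [Finset.mem_insert, Finset.mem_singleton]; omega
    · simp only [Finset.mem_insert, Finset.mem_singleton]; omega
  · rw [weightDistribution_range E hE]
    -- The zero functional lies in the class of weight `2 ^ (k - 2)`, but its word has weight zero.
    have hpt (H : Module.Dual (ZMod 2) V) : (X : ℤ[X]) ^ AdditiveCode.weight (E H) +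
        (if H = 0 then X ^ 2 ^ (k - 2) else 0) =
        (if H = 0 then 1 else 0) +
        (if H ∉ U.dualAnnihilator ∧ H P = 0 then X ^ d else 0) +
        (if H ∉ U.dualAnnihilator ∧ H P = 1 then X ^ (d + 1) else 0) +
        (if H ∈ U.dualAnnihilator ∧ H P = 0 then X ^ 2 ^ (k - 2) else 0) +
        (if H ∈ U.dualAnnihilator ∧ H P = 1 then X ^ (2 ^ (k - 2) + 1) else 0) := by
      by_cases hH : H = 0
      · subst hH
        rw [hE0]
        simp
      · by_cases hA : H ∈ U.dualAnnihilator
        · rw [(hw hH).1 hA]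
          rcases ZMod.two_eq_zero_or_eq_one (H P) with hp | hp <;> simp [hH, hA, hp, hval1]
        · rw [(hw hH).2 hA]
          rcases ZMod.two_eq_zero_or_eq_one (H P) with hp | hp <;> simp [hH, hA, hp, hval1]
    have hsum := Finset.sum_congr (rfl : (Finset.univ : Finset (Module.Dual (ZMod 2) V)) = _)
      fun H _ => hpt H
    simp only [Finset.sum_add_distrib, Finset.sum_ite_eq', Finset.mem_univ, if_true] at hsum
    simp only [← Finset.sum_filter, Finset.sum_const, nsmul_eq_mul] at hsum
    have cB0' := congrArg (Nat.cast (R := ℤ[X])) cB0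
    have cB1' := congrArg (Nat.cast (R := ℤ[X])) cB1
    rw [cA0, cA1] at hsum
    push_cast at cB0' cB1' hsum
    rw [eq_sub_of_add_eq cB0', eq_sub_of_add_eq cB1'] at hsum
    linear_combination hsum
  · -- The functionals vanishing at `P` give the complementary subcode.
    let Z : AddSubgroup (Module.Dual (ZMod 2) V) :=
      (LinearMap.ker (Module.Dual.eval (ZMod 2) V P)).toAddSubgroup
    have hZ (H : Module.Dual (ZMod 2) V) : H ∈ Z ↔ H P = 0 := Iff.rfl
    have hKK : K + K = 0 := by
      ext v
      rw [LinearMap.add_apply, CharTwo.add_self_eq_zero, LinearMap.zero_apply]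
    have hS (c : Fin n → F4) : c ∈ AddSubgroup.zmultiples (E K) ↔ c = 0 ∨ c = E K := by
      constructor
      · rintro ⟨m, rfl⟩
        have h2 : (2 : ℤ) • E K = 0 := by rw [two_zsmul, ← map_add, hKK, map_zero]
        rcases Int.even_or_odd' m with ⟨j, rfl | rfl⟩
        · left
          simp only [mul_comm (2 : ℤ) j, mul_smul, h2, smul_zero]
        · right
          simp only [add_smul, mul_comm (2 : ℤ) j, mul_smul, h2, smul_zero, zero_add, one_smul]
      · rintro (rfl | rfl)
        · exact zero_mem _
        · exact AddSubgroup.mem_zmultiples _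
    have hcardS : Nat.card (AddSubgroup.zmultiples (E K)) = 2 ^ 1 := by
      rw [Nat.card_zmultiples, pow_one]
      exact addOrderOf_eq_prime (by rw [two_nsmul, ← map_add, hKK, map_zero]) (hEne.2 hKn)
    refine ⟨AddSubgroup.zmultiples (E K), (k : ℝ) / 2, d, Z.map E, hparams, ?_, ?_, ?_,
      ⟨?_, ?_, ?_⟩, ⟨?_, ?_, ?_⟩, ⟨?_, ?_⟩, Nat.lt_succ_self d⟩
    · rintro _ ⟨H, -, rfl⟩
      exact ⟨H, rfl⟩
    · rw [AddSubgroup.zmultiples_le]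
      exact ⟨K, rfl⟩
    · rw [AddSubgroup.disjoint_def]
      rintro _ ⟨H, hH, rfl⟩ hc
      rcases (hS _).1 hc with hc | hc
      · exact hc
      · have hHP : H P = 0 := hH
        rw [hE hc, hKP] at hHP
        exact absurd hHP one_ne_zero
    · have hcard : Nat.card (Z.map E) = 2 ^ (k - 1) := by
        rw [← cP, Nat.card_congr (Z.equivMapOfInjective E hE).toEquiv.symm,
          Nat.card_eq_fintype_card]
        exact Fintype.card_of_subtype _ fun H => by rw [hZ]; simp
      rw [dim_eq_half hcard, Nat.cast_sub (by omega)]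
      push_cast
      ring
    · exact ⟨E HB0, ⟨HB0, hB0P, rfl⟩, hEne.2 hB0n, wB0⟩
    · rintro _ ⟨_, ⟨H, -, rfl⟩, hH, rfl⟩
      exact hcases (hEne.1 hH)
    · rw [dim_eq_half hcardS, Nat.cast_one]
    · exact ⟨E K, AddSubgroup.mem_zmultiples _, hEne.2 hKn, wK⟩
    · rintro _ ⟨c, hc, hc0, rfl⟩
      rcases (hS c).1 hc with rfl | rfl
      · exact absurd rfl hc0
      · exact wK.ge
    · have hLn : L ≠ 0 := by
        rintro rfl
        exact zero_ne_one hLP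
      refine ⟨E (L + K), ⟨L + K, ?_, rfl⟩, hEne.2 fun hz => hLK ?_, E K,
        AddSubgroup.mem_zmultiples _, hEne.2 hKn, ?_⟩
      · change (L + K) P = 0
        rw [LinearMap.add_apply, hLP, hKP]
        rfl
      · have := congrArg (· + K) hz
        simpa [add_assoc, hKK] using this
      · rw [← map_add, add_assoc, hKK, add_zero, (hw hLn).2 hL, hLP, hval1]
    · rintro _ ⟨_, ⟨H, hH, rfl⟩, hH0, c, hc, hc0, rfl⟩
      rcases (hS c).1 hc with rfl | rfl
      · exact absurd rfl hc0
      have hHP : (H + K) P = 1 := by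
        have : H P = 0 := hH
        rw [LinearMap.add_apply, this, hKP, zero_add]
      have hne : H + K ≠ 0 := fun hz => by
        rw [hz] at hHP
        exact zero_ne_one hHP
      rw [← map_add]
      by_cases hA : H + K ∈ U.dualAnnihilator
      · rw [(hw hne).1 hA, hHP, hval1]
        omega
      · rw [(hw hne).2 hA, hHP, hval1]

end CoverCode

open Classical in
/-- Line covers exist for all dimensions `k = 2 (s + r) + 3` and `k₂ = 2 s`. -/
theorem exists_isLineCover (s r : ℕ) :
    ∃ (U : Submodule (ZMod 2) (((Fin s → F4) × (Fin r → F4)) × F8))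
      (P : ((Fin s → F4) × (Fin r → F4)) × F8),
      Nat.card U = 2 ^ (2 * s) ∧ P ∉ U ∧
      ∀ [Fintype (((Fin s → F4) × (Fin r → F4)) × F8)],
      ∃ (n : ℕ) (p q : Fin n → ((Fin s → F4) × (Fin r → F4)) × F8), IsLineCover U P p q := by
  let U₀ : Submodule F4 ((Fin s → F4) × (Fin r → F4)) := LinearMap.ker (LinearMap.snd F4 _ _)
  have := Fintype.ofFinite ((Fin s → F4) × (Fin r → F4))
  obtain ⟨n, p, q, h⟩ := exists_line_cover U₀
  refine ⟨(U₀.restrictScalars (ZMod 2)).prod ⊥, (0, F8.pt), ?_, ?_, @fun _ => ⟨n, p, q, fun f => ?_⟩⟩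
  · have hcard : Nat.card (Fin s → F4) = 2 ^ (2 * s) := by
      rw [Nat.card_fun, F4.natCard, Nat.card_eq_fintype_card, Fintype.card_fin, pow_mul]
      norm_num
    rw [← hcard]
    exact Nat.card_congr
      { toFun := fun u => u.1.1.1
        invFun := fun a => ⟨((a, 0), 0), rfl, rfl⟩
        left_inv := by
          rintro ⟨⟨⟨a, b⟩, x⟩, hb, hx⟩
          exact Subtype.ext (Prod.ext (Prod.ext rfl (Eq.symm hb)) (Eq.symm hx))
        right_inv := fun _ => rfl }
  · rintro ⟨-, hx⟩
    exact absurd (show F8.pt = 0 from hx) (by decide)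
  · convert h f using 4
    rfl

theorem mainTheorem9 (k k₁ k₂ : ℕ) (hk : 7 ≤ k) (hkodd : Odd k)
    (hk₂ : 4 ≤ k₂) (hk₂even : Even k₂) (hk₂k : k₂ ≤ k - 3) (hk₁ : k₁ = k - k₂) :
    ∃ n d : ℕ, 3 * n = 2 ^ k - 2 ^ k₂ + 2 ∧ d = 2 ^ (k - 2) - 2 ^ (k₂ - 2) ∧
      ∃ C : AdditiveCode.Code n,
        AdditiveCode.HasParams C ((k : ℝ) / 2) d ∧
        AdditiveCode.IsWeightCode 4 C ∧
        AdditiveCode.weightDistribution C =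
          1 + (2 ^ (k - 1) - 2 ^ (k₁ - 1)) * X ^ d
            + (2 ^ (k - 1) - 2 ^ (k₁ - 1)) * X ^ (d + 1)
            + (2 ^ (k₁ - 1) - 1) * X ^ (2 ^ (k - 2))
            + 2 ^ (k₁ - 1) * X ^ (2 ^ (k - 2) + 1) ∧
        (∃ S : AdditiveCode.Code n, AdditiveCode.IsInvariantSubcode S C (1 / 2) (d + 1)) ∧
        AdditiveCode.IsGDO C ∧
        (k₂ ≠ 4 → AdditiveCode.IsGPO C) := by
  obtain ⟨s, hs⟩ := hk₂even
  obtain ⟨m, hm⟩ := hkodd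
  obtain ⟨r, hr⟩ : ∃ r, k = 2 * (s + r) + 3 := ⟨m - 1 - s, by omega⟩
  subst hk₁
  have := Fintype.ofFinite (((Fin s → F4) × (Fin r → F4)) × F8)
  obtain ⟨U, P, hU, hP, hcov⟩ := exists_isLineCover s r
  obtain ⟨n, p, q, h⟩ := hcov
  have hV : Nat.card (((Fin s → F4) × (Fin r → F4)) × F8) = 2 ^ k := by
    have h8 : Nat.card F8 = 2 ^ 3 := by simp [F8]
    rw [Nat.card_prod, Nat.card_prod, Nat.card_fun, Nat.card_fun, F4.natCard, h8, hr]
    simp only [Nat.card_eq_fintype_card, Fintype.card_fin]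
    rw [show 4 = 2 ^ 2 by norm_num, ← pow_mul, ← pow_mul, ← pow_add, ← pow_add]
    congr 1
    ring
  have hU : Nat.card U = 2 ^ k₂ := by rw [hU]; congr 1; omega
  have hn := h.three_mul_add_card
  rw [hU, hV] at hn
  have hlt : 2 ^ k₂ < 2 ^ k := Nat.pow_lt_pow_right (by norm_num) (by omega)
  have hg := griesmer_add_two_pow (k := k) (k₂ := k₂) (by omega) (by omega)
  have e1 : 2 ^ k = 4 * 2 ^ (k - 2) := by
    rw [show 4 = 2 ^ 2 by norm_num, ← pow_add]; congr 1; omega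
  have e2 : 2 ^ k₂ = 4 * 2 ^ (k₂ - 2) := by
    rw [show 4 = 2 ^ 2 by norm_num, ← pow_add]; congr 1; omega
  obtain ⟨C, hC, hC4, hCw, hCS⟩ := h.exists_code hk₂ (by omega) hV hU hP rfl
  exact ⟨n, _, by omega, rfl, C, hC, hC4, hCw, hCS, ⟨k, _, hC, by omega, by omega⟩,
    fun hne => ⟨k, _, hC, by omega, by omega⟩⟩
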